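/- Let $F$ be a field of characteristic $2$ with more than $4$ elements, let $k\ge 2$, and let $V=F^{2k}$ with coordinates $x_0,\dots,x_{2k-1}$ and the symmetric bilinear form $$\xi(x,y)=x_0y_0+\sum_{i=0}^{k-1}\bigl(x_{2i}y_{2i+1}+x_{2i+1}y_{2i}\bigr).$$ For a subspace $U$ of $V$ let $U^\perp$ be its orthogonal complement with respect to $\xi$; call $U$ regular if $U\cap U^\perp=0$. Let $\mathfrak G_1$ be the point-line geometry whose points and lines are the regular subspaces of $V$ of dimension $1$ and $2$, with inclusion as incidence, and let $\mathfrak B_1$ be obtained from $\mathfrak G_1$ by deleting its isolated points (those on no line) and isolated lines (those through no point). An automorphism of $\mathfrak B_1$ is a bijection of its points together with a bijection of its lines that preserve incidence in both directions. Let $W=\{x\in V:x_0=0\}$, which determines the hyperplane $\mathbf H$ of selfconjugate points (the one-dimensional subspaces $\langle v\rangle$ with $\xi(v,v)=0$); its pole $\mathbf b=\langle(0,1,0,\dots,0)\rangle$ lies on $\mathbf H$. Let $\xi_0$ be the restriction of $\xi$ to $W$, let $\perp_{\mathbf H}$ be the conjugacy $\langle x\rangle\perp_{\mathbf H}\langle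 y\rangle\iff\xi_0(x,y)=0$ on $\mathbf H$, and let $\pi_1:W\to F$, $\pi_1(y)=y_1$. Identify $W$ with the point set of $\mathfrak B_1$ through the bijection $x\mapsto\langle e_0+x\rangle$, where $e_0=(1,0,\dots,0)$. Then for every map $f:W\to W$ the following conditions are equivalent: (i) $f$ is (the point map of) an automorphism of $\mathfrak B_1$; (ii) there are a semilinear bijection $\varphi\in\Gamma L(W)$ (semilinear with respect to some automorphism of $F$) and a vector $\omega\in W$ such that $f(x)=\varphi(x)+\omega$ for all $x\in W$, the map $\varphi$ preserves $\perp_{\mathbf H}$ (that is, $\xi_0(x,y)=0\iff\xi_0(\varphi(x),\varphi(y))=0$ for all $x,y\in W$), and $$\xi_0(x,y)=\pi_1(y)\ \Longrightarrow\ \xi_0(\varphi(x),\varphi(y))+\xi_0(\omega,\varphi(y))=\pi_1(\varphi(y))\qquad\text{for all }x,y\in W.$$ -/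

import Mathlib

namespace PseudoPolarity

universe u

/-- A point-line geometry: points, lines and an incidence relation. -/
structure PointLineGeometry where
  Point : Type u
  Line : Type u
  Inc : Point → Line → Prop

namespace PointLineGeometry

/-- An automorphism of a point-line geometry: a bijection of the points together with a bijection
of the lines such that incidence is preserved in both directions. -/
structure Aut (G : PointLineGeometry.{u}) where
  onPoints : Equiv.Perm G.Point
  onLines : Equiv.Perm G.Line
  inc_iff : ∀ p l, G.Inc (onPoints p) (onLines l) ↔ G.Inc p l

/-- The geometry obtained by deleting isolated points (points on no line) and isolated lines
(lines through no point). -/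
def deleteIsolated (G : PointLineGeometry.{u}) : PointLineGeometry.{u} where
  Point := {p : G.Point // ∃ l, G.Inc p l}
  Line := {l : G.Line // ∃ p, G.Inc p l}
  Inc p l := G.Inc p.1 l.1

end PointLineGeometry

section Regular

variable {F V : Type u} [Field F] [AddCommGroup V] [Module F V]

/-- The radical `U ∩ U^⊥` of a subspace with respect to a bilinear form. -/
def rad (ξ : LinearMap.BilinForm F V) (U : Submodule F V) : Submodule F V :=
  U ⊓ ξ.orthogonal U

/-- A subspace is regular when its radical is trivial. -/
def IsRegular (ξ : LinearMap.BilinForm F V) (U : Submodule F V) : Prop :=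
  rad ξ U = ⊥

/-- The regular subspaces of (vector space) dimension `k`. -/
def RegularSubspace (ξ : LinearMap.BilinForm F V) (k : ℕ) : Type u :=
  {U : Submodule F V // IsRegular ξ U ∧ Module.finrank F U = k}

/-- The Grassmannian of regular points and regular lines; incidence is inclusion. -/
def regularGrassmannian (ξ : LinearMap.BilinForm F V) : PointLineGeometry.{u} where
  Point := RegularSubspace ξ 1
  Line := RegularSubspace ξ 2
  Inc p L := p.1 ≤ L.1

/-- The geometry of non-isolated regular points and non-isolated regular lines. -/
def regularGeometry (ξ : LinearMap.BilinForm F V) : PointLineGeometry.{u} :=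
  (regularGrassmannian ξ).deleteIsolated

end Regular

/-! Coordinates `x_0, …, x_{2k-1}` on `F^{2k}`. -/

/-- The even index `2 i`. -/
def ev {k : ℕ} (i : Fin k) : Fin (2 * k) := ⟨2 * i.1, by omega⟩

/-- The odd index `2 i + 1`. -/
def od {k : ℕ} (i : Fin k) : Fin (2 * k) := ⟨2 * i.1 + 1, by omega⟩

/-- The index `0`. -/
def idx0 (k : ℕ) [NeZero k] : Fin (2 * k) := ⟨0, by have := NeZero.pos k; omega⟩

/-- The index `1`. -/
def idx1 (k : ℕ) [NeZero k] : Fin (2 * k) := ⟨1, by have := NeZero.pos k; omega⟩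

section Form

variable (F : Type u) [Field F] (k : ℕ) [NeZero k]

/-- The form `ξ(x, y) = x_0 y_0 + ∑_{i < k} (x_{2i} y_{2i+1} + x_{2i+1} y_{2i})` on `F^{2k}`. -/
def form : LinearMap.BilinForm F (Fin (2 * k) → F) :=
  LinearMap.mk₂ F
    (fun x y => x (idx0 k) * y (idx0 k)
      + ∑ i : Fin k, (x (ev i) * y (od i) + x (od i) * y (ev i)))
    (by
      intro x x' y
      simp only [Pi.add_apply, add_mul, Finset.sum_add_distrib]
      ring)
    (by
      intro c x y
      simp only [Pi.smul_apply, smul_eq_mul, mul_add, Finset.mul_sum, mul_assoc])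
    (by
      intro x y y'
      simp only [Pi.add_apply, mul_add, Finset.sum_add_distrib]
      ring)
    (by
      intro c x y
      simp only [Pi.smul_apply, smul_eq_mul, mul_add, Finset.mul_sum, mul_left_comm])

/-- The subspace `W : x_0 = 0`, whose points form the hyperplane `H`. -/
def W : Submodule F (Fin (2 * k) → F) := LinearMap.ker (LinearMap.proj (idx0 k))

/-- The restriction `ξ₀` of `ξ` to `W`. -/
def form₀ : LinearMap.BilinForm F (W F k) := (form F k).restrict (W F k)

/-- The projection `π₁ : W → F`, `y ↦ y_1`. -/
def proj₁ : W F k →ₗ[F] F := (LinearMap.proj (idx1 k)).comp (W F k).subtype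

/-- A self-map of `W` preserves the conjugacy `⟨u⟩ ⊥ ⟨v⟩ ↔ ξ₀(u, v) = 0` on `H`. -/
def PreservesPerpH (φ : W F k → W F k) : Prop :=
  ∀ x y, form₀ F k (φ x) (φ y) = 0 ↔ form₀ F k x y = 0

/-- The vector `[1, x]`, for `x ∈ W`. -/
def affineVector (x : W F k) : Fin (2 * k) → F := Pi.single (idx0 k) 1 + x.1

end Form

section Facts

variable {F : Type u} [Field F] {k : ℕ} [NeZero k]

theorem form_apply (x y : Fin (2 * k) → F) :
    form F k x y = x (idx0 k) * y (idx0 k)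
      + ∑ i : Fin k, (x (ev i) * y (od i) + x (od i) * y (ev i)) := rfl

theorem form_self [CharP F 2] (x : Fin (2 * k) → F) :
    form F k x x = x (idx0 k) * x (idx0 k) := by
  rw [form_apply]
  simp [mul_comm, CharTwo.add_self_eq_zero]

/-- The points of `H` are exactly the selfconjugate points. -/
theorem mem_W_iff [CharP F 2] (x : Fin (2 * k) → F) : x ∈ W F k ↔ form F k x x = 0 := by
  rw [form_self]
  simp [W]

theorem idx0_ne_idx1 : idx0 k ≠ idx1 k := by
  intro h
  simp [idx1, idx0] at h

/-- The vector `[0, 1, 0, …, 0]` spans the pole of `H`. -/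
theorem form_single_one (x : Fin (2 * k) → F) :
    form F k (Pi.single (idx1 k) 1) x = x (idx0 k) := by
  rw [form_apply, Finset.sum_eq_single (⟨0, NeZero.pos k⟩ : Fin k)]
  · simp [ev, od, idx0, idx1]
  · intro i _ hi
    have : (i : ℕ) ≠ 0 := fun h => hi (Fin.ext h)
    have h1 : ev i ≠ idx1 k := by
      intro h
      have := congrArg Fin.val h
      simp only [ev, idx1] at this
      omega
    have h2 : od i ≠ idx1 k := by
      intro h
      have := congrArg Fin.val h
      simp only [od, idx1] at this
      omega
    simp [h1, h2]
  · simp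

theorem form_comm (x y : Fin (2 * k) → F) : form F k x y = form F k y x := by
  rw [form_apply, form_apply, mul_comm]
  congr 1
  exact Finset.sum_congr rfl fun i _ => by ring

@[simp] theorem affineVector_zero (x : W F k) : affineVector F k x (idx0 k) = 1 := by
  have : x.1 (idx0 k) = 0 := x.2
  simp [affineVector, this]

theorem affineVector_ne_zero (x : W F k) : affineVector F k x ≠ 0 := by
  intro h
  have := affineVector_zero x
  rw [h] at this
  simp at this

theorem isRegular_affinePoint [CharP F 2] (x : W F k) :
    IsRegular (form F k) (Submodule.span F {affineVector F k x}) := by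
  rw [IsRegular, rad, eq_bot_iff]
  rintro v ⟨hv, hv'⟩
  obtain ⟨c, rfl⟩ := Submodule.mem_span_singleton.1 hv
  have := hv' _ (Submodule.mem_span_singleton_self _)
  simp [form_self] at this
  simp [this]

/-- The regular line joining `[1, x]` with the pole of `H`. -/
theorem isRegular_affineLine (x : W F k) :
    IsRegular (form F k)
      (Submodule.span F {affineVector F k x, Pi.single (idx1 k) 1}) := by
  rw [IsRegular, rad, eq_bot_iff]
  rintro v ⟨hv, hv'⟩
  obtain ⟨a, b, rfl⟩ := Submodule.mem_span_pair.1 hv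
  have h1 := hv' _ (Submodule.subset_span (Set.mem_insert_of_mem _ rfl))
  have ha : a = 0 := by
    simpa [form_single_one, idx0_ne_idx1] using h1
  have h2 := hv' _ (Submodule.subset_span (Set.mem_insert _ _))
  have hb : b = 0 := by
    simpa [ha, form_comm (affineVector F k x),
      form_single_one] using h2
  simp [ha, hb]

theorem finrank_affineLine (x : W F k) :
    Module.finrank F
      (Submodule.span F {affineVector F k x, Pi.single (idx1 k) (1 : F)}) = 2 := by
  have h : LinearIndependent F ![affineVector F k x, Pi.single (idx1 k) (1 : F)] := by
    rw [LinearIndependent.pair_iff]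
    intro s t hst
    have h0 := congrFun hst (idx0 k)
    have hs : s = 0 := by simpa [idx0_ne_idx1] using h0
    have h1 := congrFun hst (idx1 k)
    exact ⟨hs, by simpa [hs] using h1⟩
  have := finrank_span_eq_card h
  rwa [Matrix.range_cons, Matrix.range_cons, Matrix.range_empty, Set.union_empty,
    Set.singleton_union, Fintype.card_fin] at this

end Facts

section Affine

variable (F : Type u) [Field F] [CharP F 2] (k : ℕ) [NeZero k]

/-- The geometry `𝔅₁` of the pseudo-polarity `ξ` on `F^{2k}`. -/
def B₁ : PointLineGeometry.{u} := regularGeometry (form F k)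

/-- The point `⟨[1, x]⟩` of `𝔅₁`; this identifies `W` with the affine points, that is, with the
points of `𝔅₁`. -/
def affinePoint (x : W F k) : (B₁ F k).Point :=
  ⟨⟨Submodule.span F {affineVector F k x}, isRegular_affinePoint x,
      finrank_span_singleton (affineVector_ne_zero x)⟩,
    ⟨⟨Submodule.span F {affineVector F k x, Pi.single (idx1 k) 1}, isRegular_affineLine x,
        finrank_affineLine x⟩,
      Submodule.span_mono (by simp)⟩⟩

theorem affinePoint_bijective : Function.Bijective (affinePoint F k) := by
  constructor
  · intro x y h
    have h' : Submodule.span F {affineVector F k x} = Submodule.span F {affineVector F k y} :=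
      congrArg (fun p : (B₁ F k).Point => p.1.1) h
    have hx : affineVector F k x ∈ Submodule.span F {affineVector F k y} :=
      h' ▸ Submodule.mem_span_singleton_self _
    obtain ⟨c, hc⟩ := Submodule.mem_span_singleton.1 hx
    have hc1 : c = 1 := by simpa using congrFun hc (idx0 k)
    rw [hc1, one_smul] at hc
    exact Subtype.ext (add_left_cancel hc).symm
  · rintro ⟨⟨U, hU, hU1⟩, hL⟩
    obtain ⟨v, hv, hv0⟩ := Submodule.exists_mem_ne_zero_of_ne_bot (p := U) (by
      rintro rfl
      simp at hU1)
    have hUv : U = Submodule.span F {v} := by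
      have : FiniteDimensional F U := Module.finite_of_finrank_eq_succ hU1
      refine (Submodule.eq_of_le_of_finrank_eq ?_ ?_).symm
      · simpa using hv
      · rw [finrank_span_singleton hv0, hU1]
    have hv1 : v (idx0 k) ≠ 0 := by
      intro h
      refine hv0 ?_
      have : v ∈ rad (form F k) U := by
        refine ⟨hv, ?_⟩
        intro w hw
        rw [hUv] at hw
        obtain ⟨c, rfl⟩ := Submodule.mem_span_singleton.1 hw
        simp [form_self, h]
      rw [show rad (form F k) U = ⊥ from hU] at this
      simpa using this
    let x : W F k := ⟨(v (idx0 k))⁻¹ • v - Pi.single (idx0 k) 1, by simp [W, hv1]⟩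
    refine ⟨x, Subtype.ext (Subtype.ext ?_)⟩
    change Submodule.span F {affineVector F k x} = U
    have : affineVector F k x = (v (idx0 k))⁻¹ • v := by simp [affineVector, x]
    rw [this, hUv]
    exact Submodule.span_singleton_smul_eq (IsUnit.mk0 _ (inv_ne_zero hv1)) v

/-- Under this identification, `f : W → W` is (the point map of) an automorphism of `𝔅₁`. -/
def IsAutB₁ (f : W F k → W F k) : Prop :=
  ∃ g : (B₁ F k).Aut, ∀ x, g.onPoints (affinePoint F k x) = affinePoint F k (f x)

end Affine

end PseudoPolarity

/-! Write `[1, x]` for `affineVector F k x`. In characteristic 2 the Gram determinant of `[1, x]`,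
`[1, z]` is `(1 + m) ^ 2` with `m = ξ([1, x], [1, z])`, so distinct affine points lie on a line of
`𝔅₁` exactly when `m ≠ 1`. The remaining pairs are the tangent ones, and with `z = x + y` tangency
reads `ξ₀(x, y) = π₁(y)` (`tangent_add_iff`).

An automorphism therefore preserves tangency and the regular affine lines. It also preserves the
nonregular affine lines: these are recovered from tangency alone, as all points tangent to
everything that is tangent to both given points (`mem_line_iff_of_tangent`). Hence automorphisms are
the bijections of `W` that preserve tangency and collinearity (`isAutB₁_iff`). The fundamental
theorem of affine geometry (`PreservesLines.exists_semilinear`) writes such a map as `φ + ω`, and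
`preserves_tangent_iff` translates tangency into conditions on `φ` and `ω`. -/

namespace PseudoPolarity

/-! ### Collineations of an affine space are semilinear up to translation. -/

section AffineGeometry

variable {K M : Type*} [Field K] [AddCommGroup M] [Module K M]

/-- A map preserving collinearity of triples in both directions. -/
def PreservesLines (K : Type*) {M : Type*} [Field K] [AddCommGroup M] [Module K M]
    (g : M → M) : Prop :=
  ∀ x z w, (∃ t : K, w = x + t • (z - x)) ↔ ∃ t : K, g w = g x + t • (g z - g x)

namespace PreservesLines

variable {g : M → M}

theorem sub_const (hl : PreservesLines K g) (c : M) : PreservesLines K fun x => g x - c := by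
  intro x z w
  rw [hl x z w]
  refine exists_congr fun t => ?_
  rw [sub_sub_sub_cancel_right, sub_add_eq_add_sub, sub_left_inj]

theorem exists_smul_iff (hl : PreservesLines K g) (h0 : g 0 = 0) (a w : M) :
    (∃ t : K, w = t • a) ↔ ∃ t : K, g w = t • g a := by
  simpa [h0] using hl 0 a w

/-- Additivity on independent vectors: parallelograms are preserved. -/
theorem map_add_of_not_mem (hl : PreservesLines K g) (hg : Function.Surjective g)
    (h0 : g 0 = 0) {c : K} (hc0 : c ≠ 0) (hc1 : c ≠ 1) {a b : M} (ha : a ≠ 0)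
    (hab : ∀ t : K, b ≠ t • a) : g (a + b) = g a + g b := by
  have hc : 1 - c ≠ 0 := sub_ne_zero.2 hc1.symm
  have hind : ∀ r s : K, r • a + s • b = 0 → r = 0 ∧ s = 0 := by
    intro r s h
    have hs : s = 0 := by
      by_contra hs
      refine hab (-(s⁻¹ * r)) ?_
      have : s⁻¹ • (r • a + s • b) = 0 := by rw [h, smul_zero]
      rw [smul_add, smul_smul, smul_smul, inv_mul_cancel₀ hs, one_smul] at this
      rw [neg_smul]
      exact eq_neg_of_add_eq_zero_right this
    subst hs
    simpa [ha] using h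
  obtain ⟨p, hp⟩ := (hl.exists_smul_iff h0 a (c⁻¹ • a)).1 ⟨_, rfl⟩
  obtain ⟨q, hq⟩ := (hl.exists_smul_iff h0 b ((1 - c)⁻¹ • b)).1 ⟨_, rfl⟩
  -- Since `a + b = c • (c⁻¹ • a) + (1 - c) • ((1 - c)⁻¹ • b)`, the sum lies on a line meeting both
  -- axes; this is where a scalar other than 0 and 1 is needed.
  obtain ⟨t, ht⟩ := (hl (c⁻¹ • a) ((1 - c)⁻¹ • b) (a + b)).1 ⟨1 - c, by
    rw [smul_sub, smul_smul, smul_smul, mul_inv_cancel₀ hc, sub_mul, mul_inv_cancel₀ hc0]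
    module⟩
  obtain ⟨α, β, h⟩ : ∃ α β : K, g (a + b) = α • g a + β • g b :=
    ⟨(1 - t) * p, t * q, by rw [ht, hp, hq]; module⟩
  -- If `β ≠ 1`, the image of the line `b + K a` meets the line of `g a`. By surjectivity the
  -- meeting point has a preimage on both `K a` and `b + K a`, but these are disjoint. The argument
  -- for `α` is symmetric.
  have hβ : β = 1 := by
    by_contra hβ
    have hβ' : 1 - β ≠ 0 := sub_ne_zero.2 (Ne.symm hβ)
    obtain ⟨v, hv⟩ := hg (((1 - β)⁻¹ * α) • g a)
    obtain ⟨r, hr⟩ := (hl.exists_smul_iff h0 a v).2 ⟨_, hv⟩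
    obtain ⟨s, hs⟩ := (hl b (a + b) v).2 ⟨(1 - β)⁻¹, by
      rw [hv, h, show α • g a + β • g b - g b = α • g a - (1 - β) • g b by module,
        smul_sub, smul_smul, smul_smul, inv_mul_cancel₀ hβ']
      module⟩
    have := hind (s - r) 1 (by
      rw [sub_smul, ← hr, hs]
      module)
    exact one_ne_zero this.2
  have hα : α = 1 := by
    by_contra hα
    have hα' : 1 - α ≠ 0 := sub_ne_zero.2 (Ne.symm hα)
    obtain ⟨v, hv⟩ := hg (((1 - α)⁻¹ * β) • g b)
    obtain ⟨r, hr⟩ := (hl.exists_smul_iff h0 b v).2 ⟨_, hv⟩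
    obtain ⟨s, hs⟩ := (hl a (a + b) v).2 ⟨(1 - α)⁻¹, by
      rw [hv, h, show α • g a + β • g b - g a = β • g b - (1 - α) • g a by module,
        smul_sub, smul_smul, smul_smul, inv_mul_cancel₀ hα']
      module⟩
    have := hind 1 (s - r) (by
      rw [sub_smul, ← hr, hs]
      module)
    exact one_ne_zero this.1
  rw [h, hα, hβ, one_smul, one_smul]

/-- Dependent vectors `a`, `s • a` are handled by adding a `d` independent of `a` and expanding `g
(a + s • a + d)` in two ways. -/
theorem map_add (hl : PreservesLines K g) (hg : Function.Surjective g)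
    (h0 : g 0 = 0) {c : K} (hc0 : c ≠ 0) (hc1 : c ≠ 1)
    (hdim : ∀ a : M, ∃ b : M, ∀ t : K, b ≠ t • a) (a b : M) : g (a + b) = g a + g b := by
  have add {a b : M} (ha : a ≠ 0) (hab : ∀ t : K, b ≠ t • a) : g (a + b) = g a + g b :=
    hl.map_add_of_not_mem hg h0 hc0 hc1 ha hab
  rcases eq_or_ne a 0 with rfl | ha
  · simp [h0]
  by_cases hab : ∀ t : K, b ≠ t • a
  · exact add ha hab
  push Not at hab
  obtain ⟨s, rfl⟩ := hab
  obtain ⟨d, hd⟩ := hdim a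
  have smul_add (s : K) : g (s • a + d) = g (s • a) + g d := by
    rcases eq_or_ne s 0 with rfl | hs
    · simp [h0]
    · exact add (smul_ne_zero hs ha) fun t => by simpa [smul_smul] using hd (t * s)
  have h1 : g (a + (s • a + d)) = g a + g (s • a + d) := add ha fun t h => by
    refine hd (t - s) ?_
    rw [sub_smul, ← h, add_sub_cancel_left]
  have h2 := smul_add (1 + s)
  rw [add_smul, one_smul, add_assoc, h1, smul_add, ← add_assoc] at h2
  exact (add_right_cancel h2).symm

theorem exists_map_smul (hl : PreservesLines K g) (hg : Function.Bijective g)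
    (h0 : g 0 = 0) (hadd : ∀ a b, g (a + b) = g a + g b)
    (hdim : ∀ a : M, ∃ b : M, ∀ t : K, b ≠ t • a) :
    ∃ σ : K → K, ∀ t a, g (t • a) = σ t • g a := by
  have hne {a : M} (ha : a ≠ 0) : g a ≠ 0 := fun h => ha (hg.1 (h.trans h0.symm))
  choose τ hτ using fun (a : M) (t : K) => (hl.exists_smul_iff h0 a (t • a)).1 ⟨t, rfl⟩
  -- For independent `a`, `b`, comparing coefficients in `g (t • (a + b))` forces both scalars to
  -- equal that of `a + b`.
  have key {a b : M} (ha : a ≠ 0) (hab : ∀ t : K, b ≠ t • a) (t : K) : τ a t = τ b t := by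
    have hgab : ∀ r : K, g b ≠ r • g a := fun r hr => by
      obtain ⟨t, ht⟩ := (hl.exists_smul_iff h0 a b).2 ⟨r, hr⟩
      exact hab t ht
    have h1 := hτ (a + b) t
    rw [smul_add, hadd, hτ, hτ, hadd, smul_add] at h1
    have h2 : (τ b t - τ (a + b) t) • g b = (τ (a + b) t - τ a t) • g a := by
      rw [sub_smul, sub_smul, sub_eq_sub_iff_add_eq_add, add_comm, h1]
    have h3 : τ b t - τ (a + b) t = 0 := by
      by_contra h
      refine hgab ((τ b t - τ (a + b) t)⁻¹ * (τ (a + b) t - τ a t)) ?_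
      rw [mul_smul, ← h2, smul_smul, inv_mul_cancel₀ h, one_smul]
    rw [h3, zero_smul, eq_comm, smul_eq_zero, or_iff_left (hne ha)] at h2
    rw [sub_eq_zero] at h2 h3
    rw [← h2, h3]
  obtain ⟨e, he⟩ := hdim 0
  have he0 : e ≠ 0 := by simpa using he 0
  refine ⟨τ e, fun t a => ?_⟩
  rcases eq_or_ne a 0 with rfl | ha
  · simp [h0]
  rw [hτ]
  by_cases hea : ∀ t : K, a ≠ t • e
  · rw [key he0 hea]
  push Not at hea
  obtain ⟨s, rfl⟩ := hea
  have hs : s ≠ 0 := fun h => ha (by simp [h])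
  -- Multiples of `e` are compared with `e` through a vector independent of both.
  obtain ⟨d, hd⟩ := hdim e
  rw [key he0 hd, key ha fun t => by simpa [smul_smul] using hd (t * s)]

/-- The fundamental theorem of affine geometry for self-maps. -/
theorem exists_semilinear (hl : PreservesLines K g) (hg : Function.Bijective g)
    {c : K} (hc0 : c ≠ 0) (hc1 : c ≠ 1) (hdim : ∀ a : M, ∃ b : M, ∀ t : K, b ≠ t • a) :
    ∃ (σ : K ≃+* K) (φ : M →ₛₗ[(σ : K →+* K)] M) (ω : M), Function.Bijective φ ∧
      ∀ x, g x = φ x + ω := by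
  let h : M → M := fun x => g x - g 0
  have hh : PreservesLines K h := hl.sub_const (g 0)
  have hb : Function.Bijective h := (Equiv.subRight (g 0)).bijective.comp hg
  have h0 : h 0 = 0 := sub_self _
  have hadd : ∀ a b, h (a + b) = h a + h b := hh.map_add hb.2 h0 hc0 hc1 hdim
  obtain ⟨σ, hσ⟩ := hh.exists_map_smul hb h0 hadd hdim
  obtain ⟨e, he⟩ := hdim 0
  have he0 : e ≠ 0 := by simpa using he 0
  have hhe : h e ≠ 0 := fun H => he0 (hb.1 (H.trans h0.symm))
  -- The ring laws for `σ` are all read off on the single nonzero vector `h e`.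
  have hinj {r s : K} (H : r • h e = s • h e) : r = s := smul_left_injective K hhe H
  have σ_bij : Function.Bijective σ := by
    constructor
    · intro r s hrs
      have : h (r • e) = h (s • e) := by rw [hσ, hσ, hrs]
      exact smul_left_injective K he0 (hb.1 this)
    · intro s
      obtain ⟨v, hv⟩ := hb.2 (s • h e)
      obtain ⟨r, rfl⟩ := (hh.exists_smul_iff h0 e v).2 ⟨s, hv⟩
      exact ⟨r, hinj ((hσ _ _).symm.trans hv)⟩
  let σ' : K ≃+* K :=
    { Equiv.ofBijective σ σ_bij with
      map_mul' := fun r s => hinj (by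
        change σ (r * s) • h e = (σ r * σ s) • h e
        rw [← hσ, mul_smul, hσ, hσ, mul_smul])
      map_add' := fun r s => hinj (by
        change σ (r + s) • h e = (σ r + σ s) • h e
        rw [← hσ, add_smul, hadd, hσ, hσ, add_smul]) }
  exact ⟨σ', { toFun := h, map_add' := hadd, map_smul' := hσ }, g 0, hb,
    fun x => (sub_add_cancel (g x) (g 0)).symm⟩

end PreservesLines

theorem preservesLines_of_semilinear {σ : K ≃+* K} (φ : M →ₛₗ[(σ : K →+* K)] M)
    (hφ : Function.Injective φ) (ω : M) : PreservesLines K fun x => φ x + ω := by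
  intro x z w
  constructor
  · rintro ⟨t, rfl⟩
    refine ⟨σ t, ?_⟩
    simp only [map_add, LinearMap.map_smulₛₗ, map_sub, RingEquiv.coe_toRingHom]
    module
  · rintro ⟨t, ht⟩
    refine ⟨σ.symm t, hφ (add_right_cancel (b := ω) (ht.trans ?_))⟩
    simp only [map_add, LinearMap.map_smulₛₗ, map_sub, RingEquiv.coe_toRingHom,
      RingEquiv.apply_symm_apply]
    module

end AffineGeometry

universe u

/-! ### The form in coordinates, its radical on `W`, and affine points. -/

section Coordinates

variable {F : Type u} [Field F] {k : ℕ}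

theorem ev_injective : Function.Injective (ev : Fin k → Fin (2 * k)) := fun i j h => by
  have := congrArg Fin.val h
  simp only [ev] at this
  exact Fin.ext (by omega)

theorem od_injective : Function.Injective (od : Fin k → Fin (2 * k)) := fun i j h => by
  have := congrArg Fin.val h
  simp only [od] at this
  exact Fin.ext (by omega)

theorem ev_ne_od (i j : Fin k) : ev i ≠ od j := fun h => by
  have := congrArg Fin.val h
  simp only [ev, od] at this
  omega

variable [NeZero k]

theorem idx0_eq : idx0 k = ev ⟨0, NeZero.pos k⟩ := rfl

theorem idx1_eq : idx1 k = od ⟨0, NeZero.pos k⟩ := rfl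

theorem form_single_od (x : Fin (2 * k) → F) (i : Fin k) :
    form F k x (Pi.single (od i) 1) = x (ev i) := by
  rw [form_apply, Finset.sum_eq_single i]
  · simp [idx0_eq, ev_ne_od]
  · intro j _ hj
    simp [ev_ne_od, od_injective.ne hj]
  · simp

theorem form_single_ev (x : Fin (2 * k) → F) {i : Fin k} (hi : ev i ≠ idx0 k) :
    form F k x (Pi.single (ev i) 1) = x (od i) := by
  rw [form_apply, Finset.sum_eq_single i]
  · simp [hi.symm, (ev_ne_od i i).symm]
  · intro j _ hj
    simp [(ev_ne_od _ _).symm, ev_injective.ne hj]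
  · simp

theorem form_single_idx0 (x : Fin (2 * k) → F) :
    form F k (Pi.single (idx0 k) 1) x = x (idx0 k) + x (idx1 k) := by
  rw [form_apply, Finset.sum_eq_single ⟨0, NeZero.pos k⟩]
  · simp [idx0_eq, idx1_eq, (ev_ne_od _ _).symm]
  · intro j _ hj
    have h0 : ev j ≠ idx0 k := ev_injective.ne hj
    have h1 : od j ≠ idx0 k := (ev_ne_od ⟨0, NeZero.pos k⟩ j).symm
    simp [h0, h1]
  · simp

variable (F k) in
/-- The vector of `W` spanning the pole of `H`. -/
def poleVector : W F k := ⟨Pi.single (idx1 k) 1, by simp [W, idx0_ne_idx1]⟩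

@[simp] theorem proj₁_poleVector : proj₁ F k (poleVector F k) = 1 := by
  simp [proj₁, poleVector]

theorem form₀_apply (x y : W F k) : form₀ F k x y = form F k x.1 y.1 := rfl

theorem form₀_comm (x y : W F k) : form₀ F k x y = form₀ F k y x := form_comm _ _

@[simp] theorem form₀_poleVector (x : W F k) : form₀ F k x (poleVector F k) = 0 := by
  rw [form₀_comm, form₀_apply]
  exact (form_single_one x.1).trans x.2

/-- The radical of `ξ₀` is spanned by the pole of `H`. -/
theorem eq_smul_poleVector {y : W F k} (h : ∀ x, form₀ F k y x = 0) :
    y = proj₁ F k y • poleVector F k := by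
  have hod (i : Fin k) : y.1 (ev i) = 0 :=
    (form_single_od y.1 i).symm.trans
      (h ⟨Pi.single (od i) 1, by simp [W, idx0_eq, ev_ne_od]⟩)
  have hev (i : Fin k) (hi : ev i ≠ idx0 k) : y.1 (od i) = 0 :=
    (form_single_ev y.1 hi).symm.trans (h ⟨Pi.single (ev i) 1, by simp [W, hi.symm]⟩)
  ext j
  rcases Nat.even_or_odd' j.1 with ⟨i, hi | hi⟩
  · have hj : j = ev ⟨i, by omega⟩ := Fin.ext hi
    rw [hj, hod]
    simp [poleVector, idx1_eq, ev_ne_od]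
  · have hj : j = od ⟨i, by omega⟩ := Fin.ext hi
    rcases Nat.eq_zero_or_pos i with rfl | hi0
    · have : j = idx1 k := hj
      rw [this]
      simp [poleVector, proj₁]
    · have hne : ev ⟨i, by omega⟩ ≠ idx0 k := fun h => by
        have := congrArg Fin.val h
        simp only [ev, idx0] at this
        omega
      rw [hj, hev _ hne]
      have : (⟨i, by omega⟩ : Fin k) ≠ ⟨0, NeZero.pos k⟩ := fun h => by
        have := congrArg Fin.val h
        simp only at this
        omega
      have : od ⟨i, by omega⟩ ≠ idx1 k := od_injective.ne this
      simp [poleVector, this]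

/-- As the kernel of one functional, `W` has dimension at least `2k - 1 > 1`. -/
theorem exists_ne_smul (hk : 2 ≤ k) (a : W F k) : ∃ b : W F k, ∀ t : F, b ≠ t • a := by
  by_contra! h
  have h1 : Module.finrank F (W F k) ≤ 1 :=
    finrank_le_one a fun b => (h b).imp fun _ => Eq.symm
  let p : (Fin (2 * k) → F) →ₗ[F] F := LinearMap.proj (idx0 k)
  have h2 : Module.finrank F (LinearMap.range p) + Module.finrank F (W F k) =
      Module.finrank F (Fin (2 * k) → F) := p.finrank_range_add_finrank_ker
  have h3 := Submodule.finrank_le (LinearMap.range p)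
  rw [Module.finrank_self] at h3
  rw [Module.finrank_fin_fun] at h2
  omega

theorem affineVector_injective : Function.Injective (affineVector F k) := fun _ _ h =>
  Subtype.ext (add_left_cancel h)

theorem affineVector_line (x z : W F k) (t : F) :
    affineVector F k (x + t • (z - x)) =
      affineVector F k x + t • (affineVector F k z - affineVector F k x) := by
  simp [affineVector, add_assoc]

theorem affineVector_mem_span_pair {x z w : W F k} :
    affineVector F k w ∈ Submodule.span F {affineVector F k x, affineVector F k z} ↔
      ∃ t : F, w = x + t • (z - x) := by
  rw [Submodule.mem_span_pair]
  constructor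
  · rintro ⟨a, b, h⟩
    have h0 : a + b = 1 := by simpa using congrFun h (idx0 k)
    refine ⟨b, affineVector_injective ?_⟩
    rw [affineVector_line, ← h, eq_sub_of_add_eq h0]
    module
  · rintro ⟨t, rfl⟩
    exact ⟨1 - t, t, by rw [affineVector_line]; module⟩

/-- By rescaling `v`. Contrapositively, if no `x` solves the equation then `y` lies in the radical
of `ξ₀`. -/
theorem exists_form₀_eq_proj₁ {v y : W F k} (h : form₀ F k v y ≠ 0) :
    ∃ x, form₀ F k x y = proj₁ F k y :=
  ⟨(proj₁ F k y / form₀ F k v y) • v, by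
    rw [map_smul, LinearMap.smul_apply, smul_eq_mul, div_mul_cancel₀ _ h]⟩

variable (F k) in
/-- The affine points `x` and `z` are equal or joined by a line which is not regular. -/
def Tangent (x z : W F k) : Prop :=
  form F k (affineVector F k x) (affineVector F k z) = 1

theorem Tangent.symm {x z : W F k} (h : Tangent F k x z) : Tangent F k z x :=
  (form_comm _ _).trans h

end Coordinates

/-! ### Tangency, regular lines, and recovering lines from tangency. -/

section Tangent

variable {F : Type u} [Field F] [CharP F 2] {k : ℕ} [NeZero k]

/-- Expand, using `ξ(e₀, x) = x₁` on `W`; `ξ₀` is alternating, so `z` may be replaced by `z - x` in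
the second slot. -/
theorem form_affineVector (x z : W F k) :
    form F k (affineVector F k x) (affineVector F k z) =
      1 + (form₀ F k x (z - x) - proj₁ F k (z - x)) := by
  have hx : x.1 (idx0 k) = 0 := x.2
  have hz : z.1 (idx0 k) = 0 := z.2
  have hxx : form₀ F k x x = 0 := by rw [form₀_apply, form_self, hx, mul_zero]
  rw [map_sub, hxx, affineVector, affineVector, map_add, map_add, LinearMap.add_apply,
    LinearMap.add_apply, form_comm x.1, form_single_idx0, form_single_idx0, form_single_idx0,
    map_sub, CharTwo.sub_eq_add, CharTwo.sub_eq_add, CharTwo.sub_eq_add, form₀_apply, proj₁]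
  simp [hx, hz, idx0_ne_idx1.symm]
  ring

theorem tangent_iff {x z : W F k} :
    Tangent F k x z ↔ form₀ F k x (z - x) = proj₁ F k (z - x) := by
  rw [Tangent, form_affineVector, add_eq_left, sub_eq_zero]

theorem tangent_add_iff {x y : W F k} :
    Tangent F k x (x + y) ↔ form₀ F k x y = proj₁ F k y := by
  rw [tangent_iff, add_sub_cancel_left]

theorem tangent_self (x : W F k) : Tangent F k x x := by simp [tangent_iff]

/-- If the product is 1, then `u + v` is a nonzero radical vector; otherwise the Gram determinant
`(ξ(u, v) + 1) ^ 2` is nonzero. -/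
theorem isRegular_span_pair {u v : Fin (2 * k) → F} (hu : form F k u u = 1)
    (hv : form F k v v = 1) (huv : u ≠ v) :
    IsRegular (form F k) (Submodule.span F {u, v}) ↔ form F k u v ≠ 1 := by
  rw [IsRegular, rad, Submodule.eq_bot_iff]
  constructor
  · intro h h1
    refine huv ((CharTwo.add_eq_zero).1 (h (u + v) ⟨?_, ?_⟩))
    · exact add_mem (Submodule.subset_span (by simp)) (Submodule.subset_span (by simp))
    · intro w hw
      obtain ⟨a, b, rfl⟩ := Submodule.mem_span_pair.1 hw
      simp [hu, hv, h1, form_comm v u, CharTwo.add_self_eq_zero]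
  · rintro h w ⟨hw, hw'⟩
    obtain ⟨a, b, rfl⟩ := Submodule.mem_span_pair.1 hw
    have h1 := hw' u (Submodule.subset_span (by simp))
    have h2 := hw' v (Submodule.subset_span (by simp))
    simp only [map_add, map_smul, smul_eq_mul, hu, hv, form_comm v u, mul_one] at h1 h2
    have h3 : form F k u v + 1 ≠ 0 := fun H => h (CharTwo.add_eq_zero.1 H)
    have ha : a = b * form F k u v := CharTwo.add_eq_zero.1 h1
    have hb : b * ((form F k u v + 1) * (form F k u v + 1)) = 0 := by
      rw [ha] at h2
      rw [← h2]
      linear_combination b * form F k u v * CharTwo.two_eq_zero (R := F)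
    have hb0 : b = 0 := by simpa [h3] using hb
    simp [ha, hb0]

theorem form_affineVector_self (x : W F k) :
    form F k (affineVector F k x) (affineVector F k x) = 1 := tangent_self x

theorem inc_affinePoint {x : W F k} {L : (B₁ F k).Line} :
    (B₁ F k).Inc (affinePoint F k x) L ↔ affineVector F k x ∈ L.1.1 :=
  Submodule.span_singleton_le_iff_mem _ _

theorem finrank_span_affineVector_pair {x z : W F k} (hxz : x ≠ z) :
    Module.finrank F
      (Submodule.span F {affineVector F k x, affineVector F k z}) = 2 := by
  have h : LinearIndependent F ![affineVector F k x, affineVector F k z] := by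
    rw [LinearIndependent.pair_iff]
    intro s t hst
    have h0 : s + t = 0 := by simpa using congrFun hst (idx0 k)
    have hs : s = t := CharTwo.add_eq_zero.1 h0
    subst hs
    rw [← smul_add, smul_eq_zero, CharTwo.add_eq_zero,
      or_iff_left (affineVector_injective.ne hxz)] at hst
    exact ⟨hst, hst⟩
  have := finrank_span_eq_card h
  rwa [Matrix.range_cons, Matrix.range_cons, Matrix.range_empty, Set.union_empty,
    Set.singleton_union, Fintype.card_fin] at this

theorem line_eq_span {x z : W F k} (hxz : x ≠ z) {L : (B₁ F k).Line}
    (hx : (B₁ F k).Inc (affinePoint F k x) L) (hz : (B₁ F k).Inc (affinePoint F k z) L) :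
    L.1.1 = Submodule.span F {affineVector F k x, affineVector F k z} := by
  have : FiniteDimensional F L.1.1 := Module.finite_of_finrank_eq_succ L.1.2.2
  refine (Submodule.eq_of_le_of_finrank_eq ?_ ?_).symm
  · rw [Submodule.span_le]
    rintro _ (rfl | rfl)
    exacts [inc_affinePoint.1 hx, inc_affinePoint.1 hz]
  · rw [finrank_span_affineVector_pair hxz, L.1.2.2]

theorem line_unique {x z : W F k} (hxz : x ≠ z) {L L' : (B₁ F k).Line}
    (hx : (B₁ F k).Inc (affinePoint F k x) L) (hz : (B₁ F k).Inc (affinePoint F k z) L)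
    (hx' : (B₁ F k).Inc (affinePoint F k x) L') (hz' : (B₁ F k).Inc (affinePoint F k z) L') :
    L = L' :=
  Subtype.ext <| Subtype.ext <| (line_eq_span hxz hx hz).trans (line_eq_span hxz hx' hz').symm

theorem inc_iff_of_inc {x z w : W F k} (hxz : x ≠ z) {L : (B₁ F k).Line}
    (hx : (B₁ F k).Inc (affinePoint F k x) L) (hz : (B₁ F k).Inc (affinePoint F k z) L) :
    (B₁ F k).Inc (affinePoint F k w) L ↔ ∃ t : F, w = x + t • (z - x) := by
  rw [inc_affinePoint, line_eq_span hxz hx hz, affineVector_mem_span_pair]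

/-- This makes tangency of distinct points a notion of incidence, hence invariant under
automorphisms. -/
theorem exists_line_iff {x z : W F k} (hxz : x ≠ z) :
    (∃ L, (B₁ F k).Inc (affinePoint F k x) L ∧ (B₁ F k).Inc (affinePoint F k z) L) ↔
      ¬ Tangent F k x z := by
  have hreg := isRegular_span_pair (form_affineVector_self x) (form_affineVector_self z)
    (affineVector_injective.ne hxz)
  constructor
  · rintro ⟨L, hx, hz⟩
    exact hreg.1 (line_eq_span hxz hx hz ▸ L.1.2.1)
  · intro h
    exact ⟨⟨⟨_, hreg.2 h, finrank_span_affineVector_pair hxz⟩, (affinePoint F k x).1,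
      Submodule.span_mono (by simp)⟩, Submodule.span_mono (by simp),
      Submodule.span_mono (by simp)⟩

theorem exists_pair_inc (L : (B₁ F k).Line) :
    ∃ x z, x ≠ z ∧ (B₁ F k).Inc (affinePoint F k x) L ∧ (B₁ F k).Inc (affinePoint F k z) L := by
  obtain ⟨p, hp⟩ := L.2
  have hp' : (B₁ F k).Inc ⟨p, L.1, hp⟩ L := hp
  obtain ⟨x, hx⟩ := (affinePoint_bijective F k).2 ⟨p, L.1, hp⟩
  rw [← hx] at hp'
  obtain ⟨v, hvL, hv⟩ : ∃ v ∈ L.1.1, v ∉ Submodule.span F {affineVector F k x} := by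
    by_contra! h
    have h1 : L.1.1 ≤ Submodule.span F {affineVector F k x} := h
    have h2 := Submodule.finrank_mono h1
    rw [L.1.2.2, finrank_span_singleton (affineVector_ne_zero x)] at h2
    omega
  -- Subtracting the `e₀`-part with a multiple of `[1, x]` gives a nonzero direction of the line
  -- inside `W`.
  let y : W F k := ⟨v - v (idx0 k) • affineVector F k x, by simp [W]⟩
  have hxL := inc_affinePoint.1 hp'
  refine ⟨x, x + y, fun h => hv ?_, hp', inc_affinePoint.2 ?_⟩
  · have hy : y.1 = 0 := congrArg Subtype.val (left_eq_add.1 h)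
    exact Submodule.mem_span_singleton.2 ⟨_, (sub_eq_zero.1 hy).symm⟩
  · have : affineVector F k (x + y) = affineVector F k x + y.1 := by
      simp [affineVector, add_assoc]
    rw [this]
    exact add_mem hxL (sub_mem hvL (L.1.1.smul_mem _ hxL))

/-- Affine lines joining tangent points are recovered from tangency alone. -/
theorem mem_line_iff_of_tangent {x z w : W F k} (hxz : Tangent F k x z) :
    (∃ t : F, w = x + t • (z - x)) ↔
      ∀ u, Tangent F k x u → Tangent F k z u → Tangent F k w u := by
  constructor
  · rintro ⟨t, rfl⟩ u hx hz
    rw [Tangent] at *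
    rw [affineVector_line]
    simp [hx, hz]
  · intro h
    let ℓ (v : W F k) : W F k →ₗ[F] F := form₀ F k v - proj₁ F k
    have htrans (v y : W F k) (hv : Tangent F k v x) :
        Tangent F k v (x + y) ↔ ℓ v y = 0 := by
      rw [tangent_iff] at hv ⊢
      rw [add_sub_right_comm, map_add, map_add, hv, add_right_inj]
      exact sub_eq_zero.symm
    have hwx : Tangent F k w x := h x (tangent_self x) hxz.symm
    -- The points tangent to `x` and `z` form `x` plus the common kernel of `ℓ x` and `ℓ z`, so this
    -- kernel lies in that of `ℓ w`.
    have hmem : ℓ w ∈ Submodule.span F (Set.range ![ℓ x, ℓ z]) := by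
      refine mem_span_of_iInf_ker_le_ker fun y hy => ?_
      rw [Submodule.mem_iInf] at hy
      exact (htrans w y hwx).1 <| h _ ((htrans x y (tangent_self x)).2 (hy 0))
        ((htrans z y hxz.symm).2 (hy 1))
    rw [Matrix.range_cons, Matrix.range_cons, Matrix.range_empty, Set.union_empty,
      Set.singleton_union, Submodule.mem_span_pair] at hmem
    obtain ⟨a, b, hab⟩ := hmem
    have hab' (y : W F k) : a * (form₀ F k x y - proj₁ F k y) +
        b * (form₀ F k z y - proj₁ F k y) = form₀ F k w y - proj₁ F k y :=
      LinearMap.congr_fun hab y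
    -- Every `ℓ v` takes the value `-1` at the pole, so the combination is affine.
    have h1 : a + b = 1 := by
      have := hab' (poleVector F k)
      simp only [form₀_poleVector, proj₁_poleVector] at this
      linear_combination -this
    obtain rfl : a = 1 - b := eq_sub_of_add_eq h1
    -- The error `d` lies in the radical, so it is a multiple of the pole. As `x` is tangent to `w`
    -- and `z`, `π₁(d) = ξ₀(x, d) = 0`, which removes it.
    let d : W F k := w - x - b • (z - x)
    have hd : d = proj₁ F k d • poleVector F k := eq_smul_poleVector fun y => by
      simp only [d, map_sub, map_smul, LinearMap.sub_apply, LinearMap.smul_apply, smul_eq_mul]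
      linear_combination -hab' y
    have hxd : form₀ F k x d = 0 := by rw [hd, map_smul, form₀_poleVector, smul_zero]
    have hd0 : proj₁ F k d = 0 := by
      rw [← hxd]
      have h2 := tangent_iff.1 hwx.symm
      have h3 := tangent_iff.1 hxz
      simp only [d, map_sub, map_smul, smul_eq_mul] at h2 h3 ⊢
      linear_combination b * h3 - h2
    rw [hd0, zero_smul] at hd
    exact ⟨b, by rw [← sub_eq_zero, ← hd]; simp only [d]; abel⟩

end Tangent

/-! ### Automorphisms as tangency-preserving collineations. -/

section Automorphisms

variable {F : Type u} [Field F] [CharP F 2] {k : ℕ} [NeZero k] {f : W F k → W F k}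

theorem IsAutB₁.bijective (hf : IsAutB₁ F k f) : Function.Bijective f := by
  obtain ⟨g, hg⟩ := hf
  have hcomp : affinePoint F k ∘ f = g.onPoints ∘ affinePoint F k := funext fun x => (hg x).symm
  rw [← (affinePoint_bijective F k).of_comp_iff' f, hcomp]
  exact g.onPoints.bijective.comp (affinePoint_bijective F k)

theorem IsAutB₁.tangent_iff (hf : IsAutB₁ F k f) (x z : W F k) :
    Tangent F k (f x) (f z) ↔ Tangent F k x z := by
  rcases eq_or_ne x z with rfl | hxz
  · simp [tangent_self]
  have hb := hf.bijective
  obtain ⟨g, hg⟩ := hf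
  rw [← not_iff_not, ← exists_line_iff hxz, ← exists_line_iff (hb.1.ne hxz),
    g.onLines.surjective.exists]
  simp only [← hg, g.inc_iff]

/-- A nontangent pair spans a line of `𝔅₁`, which is carried along by incidence; for a tangent pair
the line is described by tangency. -/
theorem IsAutB₁.preservesLines (hf : IsAutB₁ F k f) : PreservesLines F f := by
  intro x z w
  rcases eq_or_ne x z with rfl | hxz
  · simp [hf.bijective.1.eq_iff]
  have hb := hf.bijective
  by_cases ht : Tangent F k x z
  · rw [mem_line_iff_of_tangent ht, mem_line_iff_of_tangent ((hf.tangent_iff x z).2 ht)]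
    refine Iff.trans ?_ hb.2.forall.symm
    simp only [hf.tangent_iff]
  · obtain ⟨L, hx, hz⟩ := (exists_line_iff hxz).2 ht
    obtain ⟨g, hg⟩ := hf
    rw [← inc_iff_of_inc hxz hx hz, ← inc_iff_of_inc (L := g.onLines L) (hb.1.ne hxz),
      ← hg, g.inc_iff] <;> rwa [← hg, g.inc_iff]

theorem exists_line_image (hb : Function.Bijective f)
    (ht : ∀ x z, Tangent F k (f x) (f z) ↔ Tangent F k x z) (hl : PreservesLines F f)
    (L : (B₁ F k).Line) : ∃ L' : (B₁ F k).Line, ∀ x,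
      (B₁ F k).Inc (affinePoint F k (f x)) L' ↔ (B₁ F k).Inc (affinePoint F k x) L := by
  obtain ⟨x, z, hxz, hx, hz⟩ := exists_pair_inc L
  obtain ⟨L', hx', hz'⟩ := (exists_line_iff (hb.1.ne hxz)).2
    ((ht x z).not.2 ((exists_line_iff hxz).1 ⟨L, hx, hz⟩))
  refine ⟨L', fun w => ?_⟩
  rw [inc_iff_of_inc hxz hx hz, inc_iff_of_inc (hb.1.ne hxz) hx' hz', hl x z w]

theorem line_ext {L L' : (B₁ F k).Line} (h : ∀ x, (B₁ F k).Inc (affinePoint F k x) L ↔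
    (B₁ F k).Inc (affinePoint F k x) L') : L = L' := by
  obtain ⟨x, z, hxz, hx, hz⟩ := exists_pair_inc L
  exact line_unique hxz hx hz ((h x).1 hx) ((h z).1 hz)

/-- The line maps induced by `f` and by its inverse are mutually inverse, because a line is
determined by its affine points. -/
theorem isAutB₁_of_preserves (hb : Function.Bijective f)
    (ht : ∀ x z, Tangent F k (f x) (f z) ↔ Tangent F k x z) (hl : PreservesLines F f) :
    IsAutB₁ F k f := by
  let e : W F k ≃ (B₁ F k).Point := Equiv.ofBijective _ (affinePoint_bijective F k)
  let f' : W F k ≃ W F k := Equiv.ofBijective f hb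
  have hf' (x : W F k) : f (f'.symm x) = x := f'.apply_symm_apply x
  choose m hm using exists_line_image hb ht hl
  choose n hn using exists_line_image (f := f'.symm) f'.symm.bijective
    (fun x z => by rw [← ht, hf', hf']) (fun x z w => by rw [hl (f'.symm x)]; simp only [hf'])
  have hmn (L : (B₁ F k).Line) : m (n L) = L := line_ext fun x => by
    rw [← hf' x, hm, hn, hf']
  have hnm (L : (B₁ F k).Line) : n (m L) = L := line_ext fun x => by
    obtain ⟨y, rfl⟩ := f'.symm.surjective x
    rw [hn, ← hm L, hf']
  refine ⟨⟨e.symm.trans (f'.trans e), ⟨m, n, hnm, hmn⟩, fun p L => ?_⟩, fun x => ?_⟩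
  · obtain ⟨x, rfl⟩ := e.surjective p
    simp only [Equiv.trans_apply, Equiv.symm_apply_apply]
    exact hm L x
  · change e (f' (e.symm (e x))) = e (f x)
    rw [Equiv.symm_apply_apply]
    rfl

theorem isAutB₁_iff : IsAutB₁ F k f ↔ Function.Bijective f ∧
    (∀ x z, Tangent F k (f x) (f z) ↔ Tangent F k x z) ∧ PreservesLines F f :=
  ⟨fun h => ⟨h.bijective, h.tangent_iff, h.preservesLines⟩,
    fun h => isAutB₁_of_preserves h.1 h.2.1 h.2.2⟩

variable {σ : F ≃+* F} {φ : W F k →ₛₗ[(σ : F →+* F)] W F k} {ω : W F k}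

theorem tangent_semilinear_iff {x y : W F k} : Tangent F k (φ x + ω) (φ (x + y) + ω) ↔
    form₀ F k (φ x) (φ y) + form₀ F k ω (φ y) = proj₁ F k (φ y) := by
  rw [map_add, add_right_comm, tangent_add_iff, map_add, LinearMap.add_apply]

/-- A semilinear bijection with translation part preserves tangency exactly when it preserves the
conjugacy on `H` and maps tangent directions to tangent directions. -/
theorem preserves_tangent_iff (hφ : Function.Bijective φ) :
    (∀ x z, Tangent F k (φ x + ω) (φ z + ω) ↔ Tangent F k x z) ↔
      PreservesPerpH F k φ ∧ ∀ x y, form₀ F k x y = proj₁ F k y →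
        form₀ F k (φ x) (φ y) + form₀ F k ω (φ y) = proj₁ F k (φ y) := by
  have hdiff : (∀ x z, Tangent F k (φ x + ω) (φ z + ω) ↔ Tangent F k x z) ↔
      ∀ x y, form₀ F k (φ x) (φ y) + form₀ F k ω (φ y) = proj₁ F k (φ y) ↔
        form₀ F k x y = proj₁ F k y := by
    simp only [← tangent_semilinear_iff, ← tangent_add_iff]
    exact ⟨fun h x y => h _ _, fun h x z => by simpa using h x (z - x)⟩
  rw [hdiff]
  constructor
  · refine fun h => ⟨fun x y => ?_, fun x y => (h x y).2⟩
    -- If `u` solves `ξ₀(u, y) = π₁(y)`, then `ξ₀(x, y) = 0` says that `x + u` solves it too. If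
    -- there is no solution, `y` and `φ y` are both radical and both sides hold.
    by_cases hy : ∃ u, form₀ F k u y = proj₁ F k y
    · obtain ⟨u, hu⟩ := hy
      have h1 := h (x + u) y
      rw [map_add, map_add, map_add, LinearMap.add_apply, LinearMap.add_apply, hu,
        add_assoc, (h u y).2 hu, add_eq_right, add_eq_right] at h1
      exact h1
    · have hφy : ¬ ∃ u, form₀ F k u (φ y) = proj₁ F k (φ y) := by
        rintro ⟨u, hu⟩
        obtain ⟨v, hv⟩ := hφ.2 (u - ω)
        refine hy ⟨v, (h v y).1 ?_⟩
        rw [hv, ← LinearMap.add_apply, ← map_add, sub_add_cancel, hu]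
      exact iff_of_true (not_not.1 fun hne => hφy (exists_form₀_eq_proj₁ hne))
        (not_not.1 fun hne => hy (exists_form₀_eq_proj₁ hne))
  · rintro ⟨hp, hi⟩ x y
    refine ⟨fun hxy => ?_, hi x y⟩
    -- The one-way implication suffices: `x` is compared with a known solution `u`, and `x - u` is
    -- controlled by conjugacy in both directions.
    by_cases hy : ∃ u, form₀ F k u y = proj₁ F k y
    · obtain ⟨u, hu⟩ := hy
      have h1 : form₀ F k (φ (x - u)) (φ y) = 0 := by
        rw [map_sub, map_sub, LinearMap.sub_apply]
        linear_combination hxy - hi u y hu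
      rw [hp, map_sub, LinearMap.sub_apply, hu] at h1
      exact sub_eq_zero.1 h1
    -- Here `φ y` is radical with `π₁(φ y) = 0`, hence zero, so `y = 0`.
    · have hrad (v : W F k) : form₀ F k v y = 0 :=
        not_not.1 fun hne => hy (exists_form₀_eq_proj₁ hne)
      have hφrad (v : W F k) : form₀ F k v (φ y) = 0 := by
        obtain ⟨v, rfl⟩ := hφ.2 v
        exact (hp v y).2 (hrad v)
      rw [hφrad, hφrad, add_zero] at hxy
      have h1 : φ y = 0 := by
        rw [eq_smul_poleVector (y := φ y) fun v => by rw [form₀_comm, hφrad], ← hxy, zero_smul]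
      have h2 : y = 0 := hφ.1 (h1.trans (map_zero φ).symm)
      simp [h2]

end Automorphisms

theorem exists_ne_zero_ne_one {F : Type*} [Field F] (hF : 2 < ENat.card F) :
    ∃ c : F, c ≠ 0 ∧ c ≠ 1 := by
  by_contra! h
  have huniv : (Set.univ : Set F) ⊆ {0, 1} := fun c _ => by
    by_cases hc : c = 0
    · exact Or.inl hc
    · exact Or.inr (h c hc)
  have := (Set.encard_le_encard huniv).trans (Set.encard_pair zero_ne_one).le
  rw [Set.encard_univ] at this
  exact absurd hF this.not_gt

end PseudoPolarity

theorem proposition3p24 {F : Type*} [Field F] [CharP F 2] (hF : 4 < ENat.card F)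
    (k : ℕ) [NeZero k] (hk : 2 ≤ k)
    (f : PseudoPolarity.W F k → PseudoPolarity.W F k) :
    PseudoPolarity.IsAutB₁ F k f ↔
      ∃ (σ : F ≃+* F)
        (φ : PseudoPolarity.W F k →ₛₗ[(σ : F →+* F)] PseudoPolarity.W F k)
        (ω : PseudoPolarity.W F k),
        Function.Bijective φ ∧
        (∀ x, f x = φ x + ω) ∧
        PseudoPolarity.PreservesPerpH F k φ ∧
        ∀ x y : PseudoPolarity.W F k,
          PseudoPolarity.form₀ F k x y = PseudoPolarity.proj₁ F k y →
            PseudoPolarity.form₀ F k (φ x) (φ y) + PseudoPolarity.form₀ F k ω (φ y)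
              = PseudoPolarity.proj₁ F k (φ y) := by
  open PseudoPolarity in
  rw [isAutB₁_iff]
  constructor
  · rintro ⟨hb, ht, hl⟩
    obtain ⟨c, hc0, hc1⟩ := exists_ne_zero_ne_one (lt_trans (by norm_num) hF)
    obtain ⟨σ, φ, ω, hφ, hf⟩ := hl.exists_semilinear hb hc0 hc1 (exists_ne_smul hk)
    simp only [hf] at ht
    exact ⟨σ, φ, ω, hφ, hf, (preserves_tangent_iff hφ).1 ht⟩
  · rintro ⟨σ, φ, ω, hφ, hf, h⟩
    obtain rfl : f = fun x => φ x + ω := funext hf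
    exact ⟨(Equiv.addRight ω).bijective.comp hφ, (preserves_tangent_iff hφ).2 h,
      preservesLines_of_semilinear φ hφ.1 ω⟩
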